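/- For a positive integer $n$ and a set $A$ of integers, let $\mathrm{Cay}(\mathbb{Z}_n; A)$ be the digraph with vertex set $\mathbb{Z}_n$ and an arc from $u$ to $u+a$ for every $u \in \mathbb{Z}_n$ and $a \in A$. All such digraphs below are assumed to be without loops, i.e. no element of $A$ is $\equiv 0 \pmod n$; the outdegree of $\mathrm{Cay}(\mathbb{Z}_n; A)$ is the number of distinct residue classes modulo $n$ of elements of $A$. Let $1 \le n < 420$, and suppose that every connected digraph $\mathrm{Cay}(\mathbb{Z}_n; B)$ of outdegree three that has no hamiltonian circuit satisfies (at least) one of the following: (i) $n = 12k$ for some integer $k \ge 1$, and there are integers $a, b$ such that, modulo $n$, $B$ is $\{6k, a, b\}$, where $\gcd(a-b, 12k) = 1$, and either $2a - 3b \equiv 6k \pmod{12k}$ or $3a - 2b \equiv 6k \pmod{12k}$; (ii) $n = 2k$ for some integer $k \ge 1$, and there are integers $a, b$ such that, modulo $n$, $B$ is $\{a, b, b+k\}$, where either $\gcd(a,b,k) \ne 1$, or all of the following hold: $\gcd(a-b,k) = 1$; $\gcd(a,2k) \ne 1$; $\gcd(b,k) \ne 1$; $a$ or $k$ is odd; and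 either $a$ is even or both $b$ and $k$ are even. Then every connected digraph $\mathrm{Cay}(\mathbb{Z}_n; A)$ of outdegree at least four has a hamiltonian circuit. -/

import Mathlib

/-- The digraph `Cay(ℤ_n; A)`, for a set `A` of integers: its vertex set is `ℤ_n`, and there is
an arc from `u` to `u + a` for every `u ∈ ℤ_n` and every `a ∈ A`. -/
def circulantDigraph (n : ℕ) (A : Set ℤ) : Digraph (ZMod n) where
  Adj u v := ∃ a ∈ A, v = u + (a : ZMod n)

namespace Digraph

variable {V : Type*}

/-- A digraph is loopless if no vertex has an arc to itself. -/
def IsLoopless (G : Digraph V) : Prop := ∀ v, ¬ G.Adj v v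

/-- A digraph is connected if its underlying undirected graph is connected. -/
def IsConnected (G : Digraph V) : Prop := G.toSimpleGraphInclusive.Connected

/-- The outdegree of a vertex: the number of its out-neighbours. -/
noncomputable def outdegree (G : Digraph V) (v : V) : ℕ := {w | G.Adj v w}.ncard

/-- A digraph has a hamiltonian circuit if its vertices can be listed, each exactly once, in a
cyclic order `c 0, c 1, …, c (m - 1)`, with an arc from each vertex to the next one
(and from `c (m - 1)` back to `c 0`, the indices being taken modulo `m`). -/
def HasHamiltonianCircuit (G : Digraph V) : Prop :=
  ∃ m : ℕ, 0 < m ∧ ∃ c : ZMod m → V, Function.Bijective c ∧ ∀ i, G.Adj (c i) (c (i + 1))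

end Digraph

/-- The first family: `Cay(ℤ_n; B)` is `Cay(ℤ_{12k}; 6k, a, b)`, where `gcd(a - b, 12k) = 1` and
either `2a - 3b ≡ 6k` or `3a - 2b ≡ 6k` modulo `12k`. -/
def IsOrderTwoType (n : ℕ) (B : Set ℤ) : Prop :=
  ∃ (k : ℕ) (a b : ℤ), n = 12 * k ∧
    circulantDigraph n B = circulantDigraph n {6 * (k : ℤ), a, b} ∧
    Int.gcd (a - b) (12 * k) = 1 ∧
    (2 * a - 3 * b ≡ 6 * k [ZMOD 12 * k] ∨ 3 * a - 2 * b ≡ 6 * k [ZMOD 12 * k])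

/-- The second family: `Cay(ℤ_n; B)` is `Cay(ℤ_{2k}; a, b, b + k)`, where `gcd(a, b, k) ≠ 1` or
the five listed arithmetic conditions hold. -/
def IsDiametricalType (n : ℕ) (B : Set ℤ) : Prop :=
  ∃ (k : ℕ) (a b : ℤ), n = 2 * k ∧
    circulantDigraph n B = circulantDigraph n {a, b, b + (k : ℤ)} ∧
    (Nat.gcd (Int.gcd a b) k ≠ 1 ∨
      (Int.gcd (a - b) k = 1 ∧
        Int.gcd a (2 * k) ≠ 1 ∧
        Int.gcd b k ≠ 1 ∧
        (Odd a ∨ Odd k) ∧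
        (Even a ∨ (Even b ∧ Even k))))

/-!
The digraph `Cay(ℤ_n; A)` only depends on the set `S` of residues of `A`, and it is connected
exactly when `S` generates `ZMod n` (`circulantDigraph_isConnected_iff`).

Suppose first that some three elements of `S` generate `ZMod n`, and that there is no hamiltonian
circuit. Then every generating triple in `S` spans a nonhamiltonian digraph of outdegree three, so
it belongs to one of the two families. Let `h = n / 2`. The first family contains `h`, and the
second one contains two elements that differ by `h`. Starting from one exceptional triple and a
fourth element `d` of `S`, one finds other generating triples; since these are exceptional too,
`S` must contain a configuration `{h, a, b, b + h}` or `{a, a + h, b, b + h}`. The parity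
conditions and the congruences of the families for the triples in such a configuration contradict
each other (`GeneratingTriplesExceptional.false_of_orderTwo_mem`,
`GeneratingTriplesExceptional.false_of_two_pairs`).

Otherwise a minimal generating subset of `S` has at least four elements. By minimality, each of
them comes with a prime divisor of `n` that divides all the others but not itself, so `n` has four
prime divisors (`exists_generating_triple_or_separating`). As `n < 420`, this leaves
`n = 2 * 3 * 5 * p` with `p = 7, 11, 13`, and four elements of `S` generate the factors of `ZMod n`
of prime order. The digraph then contains the product of directed cycles of lengths `2`, `3`, `5`,
`p`, which has an explicit hamiltonian circuit (`productWord`).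
-/

/-! ### Circulant digraphs and residues -/

lemma circulantDigraph_adj_iff {n : ℕ} {A : Set ℤ} {u v : ZMod n} :
    (circulantDigraph n A).Adj u v ↔ v - u ∈ ((↑) '' A : Set (ZMod n)) := by
  simp only [circulantDigraph, Set.mem_image]
  refine exists_congr fun a => and_congr_right fun _ => ?_
  rw [eq_comm, ← eq_sub_iff_add_eq', eq_comm, eq_comm]

lemma image_cast_eq_of_circulantDigraph_eq {n : ℕ} {A B : Set ℤ}
    (h : circulantDigraph n A = circulantDigraph n B) :
    ((↑) '' A : Set (ZMod n)) = (↑) '' B := by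
  ext x
  have hA := circulantDigraph_adj_iff (A := A) (u := (0 : ZMod n)) (v := x)
  have hB := circulantDigraph_adj_iff (A := B) (u := (0 : ZMod n)) (v := x)
  rw [sub_zero] at hA hB
  rw [← hA, ← hB, h]

lemma circulantDigraph_isLoopless_iff {n : ℕ} {A : Set ℤ} :
    (circulantDigraph n A).IsLoopless ↔ (0 : ZMod n) ∉ ((↑) '' A : Set (ZMod n)) := by
  simp only [Digraph.IsLoopless, circulantDigraph_adj_iff, sub_self, forall_const]

lemma circulantDigraph_outdegree {n : ℕ} {A : Set ℤ} (v : ZMod n) :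
    (circulantDigraph n A).outdegree v = ((↑) '' A : Set (ZMod n)).ncard := by
  rw [Digraph.outdegree, ← Set.ncard_image_of_injective _ (sub_left_injective (b := v))]
  congr 1
  ext x
  simp only [circulantDigraph_adj_iff, Set.mem_image, Set.mem_ofPred_eq]
  constructor
  · rintro ⟨w, hw, rfl⟩
    exact hw
  · exact fun hx => ⟨x + v, by simpa using hx, by simp⟩

lemma circulantDigraph_isConnected_iff {n : ℕ} {A : Set ℤ} :
    (circulantDigraph n A).IsConnected ↔
      AddSubgroup.closure ((↑) '' A : Set (ZMod n)) = ⊤ := by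
  rw [Digraph.IsConnected, SimpleGraph.connected_iff]
  constructor
  · rintro ⟨hpre, -⟩
    rw [eq_top_iff]
    intro x _
    obtain ⟨w⟩ := hpre 0 x
    suffices key : ∀ u v : ZMod n,
        (circulantDigraph n A).toSimpleGraphInclusive.Walk u v →
          v - u ∈ AddSubgroup.closure ((↑) '' A : Set (ZMod n)) by
      simpa using key _ _ w
    intro u v w
    induction w with
    | nil => simp
    | @cons u v w h _ ih =>
      have : v - u ∈ AddSubgroup.closure ((↑) '' A : Set (ZMod n)) := by
        rcases h.2 with h | h
        · exact AddSubgroup.subset_closure (circulantDigraph_adj_iff.1 h)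
        · rw [← neg_sub]
          exact neg_mem (AddSubgroup.subset_closure (circulantDigraph_adj_iff.1 h))
      simpa using add_mem ih this
  · intro htop
    refine ⟨?_, ⟨0⟩⟩
    have key : ∀ x ∈ AddSubgroup.closure ((↑) '' A : Set (ZMod n)), ∀ u : ZMod n,
        (circulantDigraph n A).toSimpleGraphInclusive.Reachable u (u + x) := by
      intro x hx
      induction hx using AddSubgroup.closure_induction with
      | mem x hx =>
        intro u
        by_cases h0 : u = u + x
        · rw [← h0]
        · exact SimpleGraph.Adj.reachable
            ⟨h0, Or.inl (circulantDigraph_adj_iff.2 (by simpa using hx))⟩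
      | zero => intro u; simp
      | add x y _ _ ihx ihy =>
        intro u
        rw [← add_assoc]
        exact (ihx u).trans (ihy _)
      | neg x _ ih =>
        intro u
        simpa using (ih (u + -x)).symm
    intro u v
    simpa using key (v - u) (htop ▸ AddSubgroup.mem_top _) u

lemma hasHamiltonianCircuit_mono {n : ℕ} {A B : Set ℤ}
    (h : ((↑) '' B : Set (ZMod n)) ⊆ (↑) '' A)
    (hB : (circulantDigraph n B).HasHamiltonianCircuit) :
    (circulantDigraph n A).HasHamiltonianCircuit := by
  obtain ⟨m, hm, c, hc, hadj⟩ := hB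
  exact ⟨m, hm, c, hc, fun i =>
    circulantDigraph_adj_iff.2 (h (circulantDigraph_adj_iff.1 (hadj i)))⟩

/-! ### Divisibility and generation in `ZMod n` -/

lemma ZMod.natCast_dvd_intCast_iff {n d : ℕ} (hd : d ∣ n) (a : ℤ) :
    (d : ZMod n) ∣ (a : ZMod n) ↔ (d : ℤ) ∣ a := by
  constructor
  · rintro ⟨c, hc⟩
    have h := congrArg (ZMod.castHom hd (ZMod d)) hc
    rw [map_intCast, map_mul, map_natCast, ZMod.natCast_self, zero_mul] at h
    exact (ZMod.intCast_zmod_eq_zero_iff_dvd a d).1 h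
  · rintro ⟨c, rfl⟩
    exact ⟨c, by push_cast; rfl⟩

lemma ZMod.closure_eq_top_of_isUnit_mem {n : ℕ} {T : Set (ZMod n)} {u : ZMod n}
    (hu : IsUnit u) (hmem : u ∈ AddSubgroup.closure T) : AddSubgroup.closure T = ⊤ := by
  obtain ⟨v, hv⟩ := hu.exists_left_inv
  rw [eq_top_iff]
  intro x _
  obtain ⟨z, hz⟩ := ZMod.intCast_surjective (x * v)
  have : x = z • u := by rw [zsmul_eq_mul, hz, mul_assoc, hv, mul_one]
  exact this ▸ zsmul_mem hmem z

lemma ZMod.closure_ne_top_of_dvd {n d : ℕ} (hd : d ∣ n) (hd1 : d ≠ 1) {T : Set (ZMod n)}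
    (hT : ∀ x ∈ T, (d : ZMod n) ∣ x) : AddSubgroup.closure T ≠ ⊤ := by
  intro htop
  have h1 : (1 : ZMod n) ∈ AddSubgroup.closure T := htop ▸ AddSubgroup.mem_top _
  have hle : ∀ x ∈ AddSubgroup.closure T, (d : ZMod n) ∣ x := by
    intro x hx
    induction hx using AddSubgroup.closure_induction with
    | mem x hx => exact hT x hx
    | zero => exact dvd_zero _
    | add x y _ _ hx hy => exact dvd_add hx hy
    | neg x _ hx => exact hx.neg_right
  have := (ZMod.natCast_dvd_intCast_iff hd 1).1 (by simpa using hle 1 h1)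
  exact hd1 (by exact_mod_cast Int.eq_one_of_dvd_one (by positivity) this)

lemma ZMod.exists_prime_dvd_of_closure_ne_top {n : ℕ} {T : Set (ZMod n)}
    (hT : AddSubgroup.closure T ≠ ⊤) :
    ∃ q : ℕ, q.Prime ∧ q ∣ n ∧ ∀ x ∈ T, (q : ZMod n) ∣ x := by
  obtain ⟨g, hg⟩ := (AddSubgroup.isAddCyclic_iff_exists_zmultiples_eq_top _).1
    (inferInstance : IsAddCyclic (AddSubgroup.closure T))
  obtain ⟨z, rfl⟩ := ZMod.intCast_surjective g
  have hgcd : Int.gcd z n ≠ 1 := by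
    intro h
    refine hT (ZMod.closure_eq_top_of_isUnit_mem (u := (z : ZMod n)) ?_ ?_)
    · rw [ZMod.coe_int_isUnit_iff_isCoprime, Int.isCoprime_iff_gcd_eq_one, Int.gcd_comm, h]
    · exact hg ▸ AddSubgroup.mem_zmultiples _
  obtain ⟨q, hq, hqd⟩ := Nat.exists_prime_and_dvd hgcd
  have hqn : q ∣ n := by
    exact_mod_cast (Int.natCast_dvd_natCast.2 hqd).trans (Int.gcd_dvd_right z n)
  refine ⟨q, hq, hqn, fun x hx => ?_⟩
  have hx' : x ∈ AddSubgroup.zmultiples (z : ZMod n) := hg ▸ AddSubgroup.subset_closure hx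
  obtain ⟨t, rfl⟩ := AddSubgroup.mem_zmultiples_iff.1 hx'
  rw [zsmul_eq_mul]
  exact Dvd.dvd.mul_left ((ZMod.natCast_dvd_intCast_iff hqn z).2
    ((Int.natCast_dvd_natCast.2 hqd).trans (Int.gcd_dvd_left z n))) _

/-! ### Exceptional triples -/

/-- The residues of a connected digraph of the first family: a triple `{h, a, b}` of `ZMod n`,
where `h` stands for the element of order two; it is even because `4 ∣ n`. -/
def IsOrderTwoTriple {n : ℕ} (h : ZMod n) (T : Set (ZMod n)) : Prop :=
  ∃ a b : ZMod n, T = {h, a, b} ∧ IsUnit (a - b) ∧ 2 ∣ h ∧ (2 * a - 3 * b = h ∨ 3 * a - 2 * b = h)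

/-- Some properties of the residues of a connected digraph of the second family: a triple
`{a, b, b + h}` of `ZMod n`, where `h` stands for the element of order two. -/
def IsDiametricalTriple {n : ℕ} (h : ZMod n) (T : Set (ZMod n)) : Prop :=
  ∃ a b : ZMod n, T = {a, b, b + h} ∧ a ≠ h ∧ (IsUnit (a - b) ∨ IsUnit (a - b - h)) ∧
    (¬ 2 ∣ a ∨ ¬ 2 ∣ h) ∧ (2 ∣ a ∨ 2 ∣ b ∧ 2 ∣ h)

lemma IsOrderTwoType.isOrderTwoTriple {n : ℕ} {B : Set ℤ} (hB : IsOrderTwoType n B) :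
    Even n ∧ IsOrderTwoTriple ((n / 2 : ℕ) : ZMod n) ((↑) '' B) := by
  obtain ⟨k, a, b, rfl, hT, hgcd, hab⟩ := hB
  have hh : (12 * k) / 2 = 6 * k := by omega
  refine ⟨⟨6 * k, by ring⟩, a, b, ?_, ?_, ?_, ?_⟩
  · rw [image_cast_eq_of_circulantDigraph_eq hT, hh]
    simp [Set.image_insert_eq]
  · rw [← Int.cast_sub, ZMod.coe_int_isUnit_iff_isCoprime, isCoprime_comm,
      Int.isCoprime_iff_gcd_eq_one]
    exact_mod_cast hgcd
  · exact ⟨3 * k, by rw [hh]; push_cast; ring⟩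
  · refine hab.imp (fun h => ?_) (fun h => ?_) <;>
    · rw [hh]
      have := (ZMod.intCast_eq_intCast_iff _ _ (12 * k)).2 (by exact_mod_cast h)
      exact_mod_cast this

lemma IsDiametricalType.isDiametricalTriple {n : ℕ} (hn : 0 < n) {B : Set ℤ}
    (hB : IsDiametricalType n B) (hgen : AddSubgroup.closure ((↑) '' B : Set (ZMod n)) = ⊤) :
    Even n ∧ IsDiametricalTriple ((n / 2 : ℕ) : ZMod n) ((↑) '' B) := by
  obtain ⟨k, a, b, rfl, hT, hcond⟩ := hB
  have hT' := image_cast_eq_of_circulantDigraph_eq hT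
  have hh : (2 * k) / 2 = k := by omega
  rcases hcond with hgcd | ⟨hab, -, hb, hodd, heven⟩
  · -- a common divisor of `a`, `b`, `k` contradicts connectedness
    exfalso
    set d := Nat.gcd (Int.gcd a b) k with hd
    have hdk : d ∣ k := Nat.gcd_dvd_right _ _
    have hdab : (d : ℤ) ∣ Int.gcd a b := Int.natCast_dvd_natCast.2 (Nat.gcd_dvd_left _ _)
    have hda : (d : ℤ) ∣ a := hdab.trans (Int.gcd_dvd_left a b)
    have hdb : (d : ℤ) ∣ b := hdab.trans (Int.gcd_dvd_right a b)
    refine ZMod.closure_ne_top_of_dvd (hdk.mul_left 2) hgcd ?_ hgen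
    rw [hT']
    rintro _ ⟨z, hz, rfl⟩
    rw [ZMod.natCast_dvd_intCast_iff (hdk.mul_left 2)]
    rcases hz with rfl | rfl | rfl
    · exact hda
    · exact hdb
    · exact dvd_add hdb (Int.natCast_dvd_natCast.2 hdk)
  · have h2 : ∀ z : ℤ, 2 ∣ (z : ZMod (2 * k)) ↔ Even z := fun z => by
      rw [even_iff_two_dvd]
      exact_mod_cast ZMod.natCast_dvd_intCast_iff (dvd_mul_right 2 k) z
    have h2k : 2 ∣ ((k : ℕ) : ZMod (2 * k)) ↔ Even k := by
      have := h2 k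
      rw [Int.cast_natCast, Int.even_coe_nat] at this
      exact this
    have hab' : IsCoprime (a - b) k := Int.isCoprime_iff_gcd_eq_one.2 hab
    rw [hh]
    refine ⟨⟨k, by ring⟩, a, b, ?_, ?_, ?_, ?_, ?_⟩
    · rw [hT']
      simp [Set.image_insert_eq]
    · intro h
      have h' : ((k : ℤ) : ZMod (2 * k)) = (a : ZMod (2 * k)) := by simpa using h.symm
      rw [ZMod.intCast_eq_intCast_iff, Int.modEq_iff_dvd] at h'
      obtain ⟨t, ht⟩ := h'
      apply hb
      rw [← Int.isCoprime_iff_gcd_eq_one]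
      have : a - b = -b + k * (1 + 2 * t) := by push_cast at ht; linear_combination ht
      rw [this] at hab'
      exact (IsCoprime.neg_left_iff _ _).1 (IsCoprime.of_add_mul_left_left hab')
    · -- of `a - b` and `a - b - k`, an odd one is coprime to `2 * k`
      have aux : ∀ z : ℤ, Odd z → IsCoprime z k → IsUnit (z : ZMod (2 * k)) := by
        intro z hz hzk
        rw [ZMod.coe_int_isUnit_iff_isCoprime, isCoprime_comm]
        push_cast
        obtain ⟨t, rfl⟩ := hz
        exact IsCoprime.mul_right ⟨1, -t, by ring⟩ hzk
      rcases Int.even_or_odd (a - b) with he | ho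
      · right
        have hk : Odd (k : ℤ) := by
          by_contra hk
          rw [Int.not_odd_iff_even] at hk
          have := hab'.isUnit_of_dvd' he.two_dvd hk.two_dvd
          exact absurd this (by decide)
        have := aux (a - b - k) (he.sub_odd hk) (by
          have := hab'.add_mul_left_left (-1)
          rwa [mul_neg_one, ← sub_eq_add_neg] at this)
        exact_mod_cast this
      · left
        exact_mod_cast aux (a - b) ho hab'
    · rw [h2, h2k, Int.not_even_iff_odd, Nat.not_even_iff_odd]
      simpa using hodd
    · rw [h2, h2k, h2]
      simpa using heven

lemma IsOrderTwoTriple.mem {n : ℕ} {h : ZMod n} {T : Set (ZMod n)} (hT : IsOrderTwoTriple h T) :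
    h ∈ T := by
  obtain ⟨a, b, rfl, -⟩ := hT
  simp

lemma IsDiametricalTriple.exists_mem {n : ℕ} {h : ZMod n} {T : Set (ZMod n)}
    (hT : IsDiametricalTriple h T) : ∃ b ∈ T, b + h ∈ T := by
  obtain ⟨a, b, rfl, -⟩ := hT
  exact ⟨b, by simp, by simp⟩

/-- In a triple of the second family, the pair that differs by `h` is determined, so that
the parity conditions may be read off from any way of writing the triple. -/
lemma IsDiametricalTriple.spec {n : ℕ} {h x y : ZMod n} (hh : 2 * h = 0) (h0 : h ≠ 0)
    (hxy : x ≠ y) (hxy' : x ≠ y + h) (hT : IsDiametricalTriple h {x, y, y + h}) :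
    x ≠ h ∧ (IsUnit (x - y) ∨ IsUnit (x - y - h)) ∧
      (¬ 2 ∣ x ∨ ¬ 2 ∣ h) ∧ (2 ∣ x ∨ 2 ∣ y ∧ 2 ∣ h) := by
  obtain ⟨a, b, hset, hah, hu, h1, h2⟩ := hT
  have hb : b = y ∨ b = y + h := by
    have hb : b ∈ ({x, y, y + h} : Set (ZMod n)) := by rw [hset]; simp
    have hbh : b + h ∈ ({x, y, y + h} : Set (ZMod n)) := by rw [hset]; simp
    simp only [Set.mem_insert_iff, Set.mem_singleton_iff] at hb hbh
    rcases hb with rfl | hb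
    · exfalso
      rcases hbh with e | e | e
      · exact h0 (by linear_combination e)
      · exact hxy' (by linear_combination e - hh)
      · exact hxy (by linear_combination e)
    · exact hb
  have ha : x = a := by
    have hx : x ∈ ({a, b, b + h} : Set (ZMod n)) := by rw [← hset]; simp
    simp only [Set.mem_insert_iff, Set.mem_singleton_iff] at hx
    rcases hx with e | e | e
    · exact e
    · rcases hb with rfl | rfl
      · exact absurd e hxy
      · exact absurd e hxy'
    · rcases hb with rfl | rfl
      · exact absurd e hxy'
      · exact absurd (show x = y by linear_combination e + hh) hxy
  subst ha
  refine ⟨hah, ?_, h1, ?_⟩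
  · rcases hb with rfl | rfl
    · exact hu
    · rw [or_comm]
      convert hu using 2
      · ring
      · linear_combination hh
  · rcases hb with rfl | rfl
    · exact h2
    · exact h2.imp_right fun ⟨p, q⟩ => ⟨(dvd_add_left q).1 p, q⟩

lemma IsOrderTwoTriple.spec {n : ℕ} {h x y : ZMod n} (hh : 2 * h = 0) (hx : x ≠ h) (hxy : x ≠ y)
    (hy : y ≠ h) (hT : IsOrderTwoTriple h {h, x, y}) :
    2 ∣ h ∧ IsUnit (x - y) ∧ (2 * x - 3 * y = h ∨ 3 * x - 2 * y = h) := by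
  obtain ⟨a, b, hset, hu, h2, hab⟩ := hT
  have hx' : x ∈ ({h, a, b} : Set (ZMod n)) := by rw [← hset]; simp
  have hy' : y ∈ ({h, a, b} : Set (ZMod n)) := by rw [← hset]; simp
  simp only [Set.mem_insert_iff, Set.mem_singleton_iff, hx, hy, false_or] at hx' hy'
  rcases hx' with rfl | rfl <;> rcases hy' with rfl | rfl
  · exact absurd rfl hxy
  · exact ⟨h2, hu, hab⟩
  · refine ⟨h2, by simpa using hu.neg, hab.symm.imp (fun e => ?_) (fun e => ?_)⟩ <;>
      linear_combination -e - hh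
  · exact absurd rfl hxy

/-! ### Four residues, all of whose generating triples are exceptional -/

section FourResidues

variable {n : ℕ} {h : ZMod n} {S : Set (ZMod n)}

/-- `S` is a set of nonzero residues all of whose generating triples are exceptional, where `h`
stands for the element of order two. -/
structure GeneratingTriplesExceptional (h : ZMod n) (S : Set (ZMod n)) : Prop where
  two_mul : 2 * h = 0
  ne_zero : h ≠ 0
  zero_notMem : 0 ∉ S
  exceptional : ∀ x ∈ S, ∀ y ∈ S, ∀ z ∈ S, x ≠ y → x ≠ z → y ≠ z →
    AddSubgroup.closure {x, y, z} = ⊤ →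
    IsOrderTwoTriple h {x, y, z} ∨ IsDiametricalTriple h {x, y, z}

namespace GeneratingTriplesExceptional

/-- A triple that contains `h` cannot be of the second family when its other two members do not
differ by `h`, since neither does `h` differ by `h` from a nonzero residue. -/
lemma orderTwo_of_mem (hS : GeneratingTriplesExceptional h S) {a b : ZMod n} (hhS : h ∈ S)
    (ha : a ∈ S) (hb : b ∈ S) (hah : a ≠ h) (hbh : b ≠ h) (hab : a ≠ b) (hab' : a ≠ b + h)
    (hgen : AddSubgroup.closure {h, a, b} = ⊤) :
    2 ∣ h ∧ IsUnit (a - b) ∧ (2 * a - 3 * b = h ∨ 3 * a - 2 * b = h) := by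
  have ha0 : a ≠ 0 := fun e => hS.zero_notMem (e ▸ ha)
  have hb0 : b ≠ 0 := fun e => hS.zero_notMem (e ▸ hb)
  have h0 := hS.ne_zero
  have hh := hS.two_mul
  rcases hS.exceptional h hhS a ha b hb hah.symm hbh.symm hab hgen with hT | hT
  · exact hT.spec hh hah hab hbh
  · exfalso
    obtain ⟨c, hc, hch⟩ := hT.exists_mem
    simp only [Set.mem_insert_iff, Set.mem_singleton_iff] at hc hch
    rcases hc with rfl | rfl | rfl <;> rcases hch with e | e | e
    · exact h0 (by linear_combination e)
    · exact ha0 (by linear_combination hh - e)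
    · exact hb0 (by linear_combination hh - e)
    · exact ha0 (by linear_combination e)
    · exact h0 (by linear_combination e)
    · exact hab' (by linear_combination e - hh)
    · exact hb0 (by linear_combination e)
    · exact hab' e.symm
    · exact h0 (by linear_combination e)

/-- A generating triple without `h` is of the second family. -/
lemma diametrical_of_notMem (hS : GeneratingTriplesExceptional h S) {x y z : ZMod n} (hx : x ∈ S)
    (hy : y ∈ S) (hz : z ∈ S) (hxy : x ≠ y) (hxz : x ≠ z) (hyz : y ≠ z) (hxh : x ≠ h)
    (hyh : y ≠ h) (hzh : z ≠ h) (hgen : AddSubgroup.closure {x, y, z} = ⊤) :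
    IsDiametricalTriple h {x, y, z} := by
  refine (hS.exceptional x hx y hy z hz hxy hxz hyz hgen).resolve_left fun hT => ?_
  simpa [hxh.symm, hyh.symm, hzh.symm] using hT.mem

lemma diametrical_spec (hS : GeneratingTriplesExceptional h S) {x y : ZMod n} (hx : x ∈ S)
    (hy : y ∈ S) (hyh : y + h ∈ S) (hxh : x ≠ h) (hxy : x ≠ y) (hxy' : x ≠ y + h)
    (hgen : AddSubgroup.closure {x, y, y + h} = ⊤) :
    (IsUnit (x - y) ∨ IsUnit (x - y - h)) ∧
      (¬ 2 ∣ x ∨ ¬ 2 ∣ h) ∧ (2 ∣ x ∨ 2 ∣ y ∧ 2 ∣ h) := by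
  have h1 : y ≠ h := fun e => hS.zero_notMem <| by
    rwa [e, ← _root_.two_mul, hS.two_mul] at hyh
  have h2 : y + h ≠ h := fun e => hS.zero_notMem <| by
    rwa [add_eq_right.1 e] at hy
  exact ((hS.diametrical_of_notMem hx hy hyh hxy hxy' (by simpa using hS.ne_zero) hxh h1 h2
    hgen).spec hS.two_mul hS.ne_zero hxy hxy').2

/-- If the closure contains `h`, it contains both `a - b` and `a - b - h`. -/
lemma closure_eq_top {T : Set (ZMod n)} {a b : ZMod n} (ha : a ∈ AddSubgroup.closure T)
    (hb : b ∈ AddSubgroup.closure T) (hhT : h ∈ AddSubgroup.closure T)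
    (hu : IsUnit (a - b) ∨ IsUnit (a - b - h)) : AddSubgroup.closure T = ⊤ := by
  rcases hu with hu | hu
  · exact ZMod.closure_eq_top_of_isUnit_mem hu (sub_mem ha hb)
  · exact ZMod.closure_eq_top_of_isUnit_mem hu (sub_mem (sub_mem ha hb) hhT)

lemma false_of_orderTwo_mem (hS : GeneratingTriplesExceptional h S) {a b : ZMod n} (hhS : h ∈ S)
    (ha : a ∈ S) (hb : b ∈ S) (hbh : b + h ∈ S) (hah : a ≠ h) (hab : a ≠ b)
    (hab' : a ≠ b + h) (hu : IsUnit (a - b) ∨ IsUnit (a - b - h)) : False := by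
  have hh := hS.two_mul
  have h1 : b ≠ h := fun e => hS.zero_notMem <| by rwa [e, ← _root_.two_mul, hh] at hbh
  have h2 : b + h ≠ h := fun e => hS.zero_notMem <| by rwa [add_eq_right.1 e] at hb
  have mem : ∀ {T : Set (ZMod n)} {x : ZMod n}, x ∈ T → x ∈ AddSubgroup.closure T :=
    fun hx => AddSubgroup.subset_closure hx
  have hb_mem : b ∈ AddSubgroup.closure {h, a, b + h} := by
    simpa using sub_mem (mem (T := {h, a, b + h}) (x := b + h) (by simp))
      (mem (T := {h, a, b + h}) (x := h) (by simp))
  have hh_mem : h ∈ AddSubgroup.closure {a, b, b + h} := by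
    simpa using sub_mem (mem (T := {a, b, b + h}) (x := b + h) (by simp))
      (mem (T := {a, b, b + h}) (x := b) (by simp))
  obtain ⟨-, hodd, -⟩ := hS.diametrical_spec ha hb hbh hah hab hab'
    (closure_eq_top (mem (by simp)) (mem (by simp)) hh_mem hu)
  obtain ⟨h2h, -, e1⟩ := hS.orderTwo_of_mem hhS ha hb hah h1 hab hab'
    (closure_eq_top (mem (by simp)) (mem (by simp)) (mem (by simp)) hu)
  obtain ⟨-, -, e2⟩ := hS.orderTwo_of_mem hhS ha hbh hah h2 hab'
    (fun e => hab (by linear_combination e + hh))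
    (closure_eq_top (mem (by simp)) hb_mem (mem (by simp)) hu)
  have ha2 : ¬ 2 ∣ a := hodd.resolve_right (not_not.2 h2h)
  -- `3 * a - 2 * b = h` would make `a` even
  have no : 3 * a - 2 * b ≠ h := by
    intro e
    obtain ⟨t, ht⟩ := h2h
    exact ha2 ⟨t + b - a, by linear_combination e + ht⟩
  have e1 := e1.resolve_right no
  rcases e2 with e2 | e2
  · exact hS.ne_zero (by linear_combination e1 - e2 - hh)
  · exact no (by linear_combination e2 + hh)

lemma false_of_two_pairs (hS : GeneratingTriplesExceptional h S) {a b : ZMod n} (ha : a ∈ S)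
    (hah : a + h ∈ S) (hb : b ∈ S) (hbh : b + h ∈ S) (hab : a ≠ b) (hab' : a ≠ b + h)
    (hu : IsUnit (a - b) ∨ IsUnit (a - b - h)) : False := by
  have hh := hS.two_mul
  have ne : ∀ {x : ZMod n}, x + h ∈ S → x ≠ h := fun hx e => hS.zero_notMem <| by
    rwa [e, ← _root_.two_mul, hh] at hx
  have ne' : ∀ {x : ZMod n}, x ∈ S → x + h ≠ h := fun hx e => hS.zero_notMem <| by
    rwa [add_eq_right.1 e] at hx
  have gen : ∀ {x y : ZMod n}, (IsUnit (x - y) ∨ IsUnit (x - y - h)) →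
      AddSubgroup.closure {x, y, y + h} = ⊤ := by
    intro x y hu
    have hy : y ∈ AddSubgroup.closure {x, y, y + h} := AddSubgroup.subset_closure (by simp)
    have hyh : y + h ∈ AddSubgroup.closure {x, y, y + h} :=
      AddSubgroup.subset_closure (by simp)
    refine closure_eq_top (AddSubgroup.subset_closure (by simp)) hy ?_ hu
    simpa using sub_mem hyh hy
  obtain ⟨-, p1, p2⟩ := hS.diametrical_spec ha hb hbh (ne hah) hab hab' (gen hu)
  obtain ⟨-, -, q2⟩ := hS.diametrical_spec hah hb hbh (ne' ha)
    (fun e => hab' (by linear_combination e - hh)) (fun e => hab (by linear_combination e))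
    (gen (hu.symm.imp (fun u => by convert u using 1; linear_combination hh)
      (fun u => by convert u using 1; ring)))
  obtain ⟨-, r1, -⟩ := hS.diametrical_spec hb ha hah (ne hbh) hab.symm
    (fun e => hab' (by linear_combination -hh - e))
    (gen (hu.imp (fun u => by convert u.neg using 1; ring)
      (fun u => by convert u.neg using 1; linear_combination -hh)))
  by_cases h2 : (2 : ZMod n) ∣ h
  · -- `a` and `b` are odd
    have ha2 := p1.resolve_right (not_not.2 h2)
    have hb2 := r1.resolve_right (not_not.2 h2)
    exact p2.elim ha2 fun e => hb2 e.1
  · -- `a` and `a + h` are even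
    have ha2 := p2.resolve_right fun e => h2 e.2
    have hah2 := q2.resolve_right fun e => h2 e.2
    exact h2 ((dvd_add_right ha2).1 hah2)

lemma false_of_orderTwoTriple (hS : GeneratingTriplesExceptional h S) {a b d : ZMod n}
    (hhS : h ∈ S) (ha : a ∈ S) (hb : b ∈ S) (hd : d ∈ S) (hah : a ≠ h) (hbh : b ≠ h)
    (hab : a ≠ b) (hab' : a ≠ b + h) (hdh : d ≠ h) (hda : d ≠ a) (hdb : d ≠ b)
    (hu : IsUnit (a - b)) : False := by
  have hh := hS.two_mul
  have h0 := hS.ne_zero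
  have hba' : b ≠ a + h := fun e => hab' (by linear_combination -hh - e)
  have hgen : AddSubgroup.closure {a, b, d} = ⊤ :=
    ZMod.closure_eq_top_of_isUnit_mem hu
      (sub_mem (AddSubgroup.subset_closure (by simp)) (AddSubgroup.subset_closure (by simp)))
  obtain ⟨c, hc, hch⟩ := (hS.diametrical_of_notMem ha hb hd hab hda.symm hdb.symm hah hbh hdh
    hgen).exists_mem
  have hd' : d = a + h ∨ d = b + h := by
    simp only [Set.mem_insert_iff, Set.mem_singleton_iff] at hc hch
    rcases hc with rfl | rfl | rfl <;> rcases hch with e | e | e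
    · exact absurd (by linear_combination e) h0
    · exact absurd e.symm hba'
    · exact Or.inl e.symm
    · exact absurd e.symm hab'
    · exact absurd (by linear_combination e) h0
    · exact Or.inr e.symm
    · exact Or.inl (by linear_combination e - hh)
    · exact Or.inr (by linear_combination e - hh)
    · exact absurd (by linear_combination e) h0
  rcases hd' with rfl | rfl
  · exact hS.false_of_orderTwo_mem hhS hb ha hd hbh hab.symm hba'
      (Or.inl (by simpa using hu.neg))
  · exact hS.false_of_orderTwo_mem hhS ha hb hd hah hab hab' (Or.inl hu)

/-- Here `a - b` is a unit, so that `{a, b, d}` generates. -/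
lemma false_of_diametricalTriple (hS : GeneratingTriplesExceptional h S) {a b d : ZMod n}
    (ha : a ∈ S) (hb : b ∈ S) (hbh : b + h ∈ S) (hd : d ∈ S) (hah : a ≠ h)
    (hab : a ≠ b) (hab' : a ≠ b + h) (hda : d ≠ a) (hdb : d ≠ b) (hdb' : d ≠ b + h)
    (hu : IsUnit (a - b)) : False := by
  have hh := hS.two_mul
  have h0 := hS.ne_zero
  have h1 : b ≠ h := fun e => hS.zero_notMem <| by rwa [e, ← _root_.two_mul, hh] at hbh
  by_cases hdh : d = h
  · subst hdh
    exact hS.false_of_orderTwo_mem hd ha hb hbh hah hab hab' (Or.inl hu)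
  · have hba' : b ≠ a + h := fun e => hab' (by linear_combination -hh - e)
    have hgen : AddSubgroup.closure {a, b, d} = ⊤ :=
      ZMod.closure_eq_top_of_isUnit_mem hu
        (sub_mem (AddSubgroup.subset_closure (by simp)) (AddSubgroup.subset_closure (by simp)))
    obtain ⟨c, hc, hch⟩ := (hS.diametrical_of_notMem ha hb hd hab hda.symm hdb.symm hah h1 hdh
      hgen).exists_mem
    have hd' : d = a + h := by
      simp only [Set.mem_insert_iff, Set.mem_singleton_iff] at hc hch
      rcases hc with rfl | rfl | rfl <;> rcases hch with e | e | e
      · exact absurd (by linear_combination e) h0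
      · exact absurd e.symm hba'
      · exact e.symm
      · exact absurd e.symm hab'
      · exact absurd (by linear_combination e) h0
      · exact absurd e.symm hdb'
      · linear_combination e - hh
      · exact absurd (by linear_combination e - hh) hdb'
      · exact absurd (by linear_combination e) h0
    subst hd'
    exact hS.false_of_two_pairs ha hd hb hbh hab hab' (Or.inl hu)

end GeneratingTriplesExceptional

end FourResidues

/-! ### Digraphs with a generating triple -/

/-- The hypothesis on digraphs of outdegree three, in terms of residues. -/
lemma exceptional_of_not_hasHamiltonianCircuit {n : ℕ} (hn : 0 < n) {A : Set ℤ}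
    (hloop : (circulantDigraph n A).IsLoopless)
    (hdescribed : ∀ B : Set ℤ,
      (circulantDigraph n B).IsLoopless →
      (circulantDigraph n B).IsConnected →
      (∀ v, (circulantDigraph n B).outdegree v = 3) →
      ¬ (circulantDigraph n B).HasHamiltonianCircuit →
      IsOrderTwoType n B ∨ IsDiametricalType n B)
    (hham : ¬ (circulantDigraph n A).HasHamiltonianCircuit) {T : Set (ZMod n)}
    (hTA : T ⊆ (↑) '' A) (hT : T.ncard = 3) (hgen : AddSubgroup.closure T = ⊤) :
    Even n ∧ (IsOrderTwoTriple ((n / 2 : ℕ) : ZMod n) T ∨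
      IsDiametricalTriple ((n / 2 : ℕ) : ZMod n) T) := by
  obtain ⟨B, rfl⟩ : ∃ B : Set ℤ, (↑) '' B = T :=
    ⟨_, Set.image_preimage_eq T ZMod.intCast_surjective⟩
  rcases hdescribed B
    (circulantDigraph_isLoopless_iff.2 fun h => circulantDigraph_isLoopless_iff.1 hloop (hTA h))
    (circulantDigraph_isConnected_iff.2 hgen)
    (fun v => by rw [circulantDigraph_outdegree, hT])
    (fun h => hham (hasHamiltonianCircuit_mono hTA h)) with hB | hB
  · exact ⟨hB.isOrderTwoTriple.1, Or.inl hB.isOrderTwoTriple.2⟩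
  · exact ⟨(hB.isDiametricalTriple hn hgen).1, Or.inr (hB.isDiametricalTriple hn hgen).2⟩

lemma pairwise_ne_of_ncard_eq_three {α : Type*} {a b c : α}
    (h : ({a, b, c} : Set α).ncard = 3) : a ≠ b ∧ a ≠ c ∧ b ≠ c := by
  refine ⟨?_, ?_, ?_⟩ <;> rintro rfl
  · rw [Set.insert_eq_of_mem (by simp)] at h
    have := Set.ncard_insert_le a {c}
    rw [Set.ncard_singleton] at this
    omega
  · rw [Set.insert_eq_of_mem (by simp)] at h
    have := Set.ncard_insert_le b {a}
    rw [Set.ncard_singleton] at this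
    omega
  · rw [Set.pair_eq_singleton] at h
    have := Set.ncard_insert_le a {b}
    rw [Set.ncard_singleton] at this
    omega

/-- Every other generating triple of the residues is exceptional as well, and the possible
exceptional triples do not fit together. -/
lemma hasHamiltonianCircuit_of_generating_triple {n : ℕ} (hn : 0 < n) {A : Set ℤ}
    (hloop : (circulantDigraph n A).IsLoopless)
    (hdescribed : ∀ B : Set ℤ,
      (circulantDigraph n B).IsLoopless →
      (circulantDigraph n B).IsConnected →
      (∀ v, (circulantDigraph n B).outdegree v = 3) →
      ¬ (circulantDigraph n B).HasHamiltonianCircuit →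
      IsOrderTwoType n B ∨ IsDiametricalType n B)
    (hcard : 4 ≤ ((↑) '' A : Set (ZMod n)).ncard) {T : Set (ZMod n)}
    (hTA : T ⊆ (↑) '' A) (hT : T.ncard = 3) (hgen : AddSubgroup.closure T = ⊤) :
    (circulantDigraph n A).HasHamiltonianCircuit := by
  have : NeZero n := ⟨hn.ne'⟩
  by_contra hham
  have key := fun {T : Set (ZMod n)} =>
    exceptional_of_not_hasHamiltonianCircuit (T := T) hn hloop hdescribed hham
  obtain ⟨heven, hTtype⟩ := key hTA hT hgen
  set S : Set (ZMod n) := (↑) '' A with hS_def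
  set h : ZMod n := ((n / 2 : ℕ) : ZMod n) with hh_def
  have hS : GeneratingTriplesExceptional h S := by
    refine ⟨?_, ?_, circulantDigraph_isLoopless_iff.1 hloop, ?_⟩
    · rw [hh_def, ← Nat.cast_ofNat, ← Nat.cast_mul, Nat.two_mul_div_two_of_even heven,
        ZMod.natCast_self]
    · rw [hh_def, Ne, ZMod.natCast_eq_zero_iff]
      intro hdvd
      obtain ⟨m, hm⟩ := heven
      have := Nat.le_of_dvd (by omega) hdvd
      omega
    · intro x hx y hy z hz hxy hxz hyz hgen
      refine (key ?_ (Set.ncard_eq_three.2 ⟨x, y, z, hxy, hxz, hyz, rfl⟩) hgen).2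
      rintro w (rfl | rfl | rfl) <;> assumption
  obtain ⟨d, hd, hdT⟩ : ∃ d ∈ S, d ∉ T :=
    Set.exists_mem_notMem_of_ncard_lt_ncard (by omega)
  have hh := hS.two_mul
  rcases hTtype with hTtype | hTtype
  · obtain ⟨a, b, rfl, hu, h2, -⟩ := hTtype
    obtain ⟨hha, hhb, hab⟩ := pairwise_ne_of_ncard_eq_three hT
    simp only [Set.mem_insert_iff, Set.mem_singleton_iff, not_or] at hdT
    obtain ⟨hdh, hda, hdb⟩ := hdT
    refine hS.false_of_orderTwoTriple (hTA (by simp)) (hTA (a := a) (by simp))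
      (hTA (a := b) (by simp)) hd hha.symm hhb.symm hab ?_ hdh hda hdb hu
    -- otherwise `h` would be a unit, although `h * h = 0`
    rintro rfl
    rw [add_sub_cancel_left] at hu
    obtain ⟨t, ht⟩ := h2
    exact hS.ne_zero (hu.mul_left_cancel (show h * h = h * 0 by linear_combination t * hh + h * ht))
  · obtain ⟨a, b, rfl, hah, hu, -⟩ := hTtype
    obtain ⟨hab, hab', -⟩ := pairwise_ne_of_ncard_eq_three hT
    simp only [Set.mem_insert_iff, Set.mem_singleton_iff, not_or] at hdT
    obtain ⟨hda, hdb, hdb'⟩ := hdT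
    have haS : a ∈ S := hTA (by simp)
    have hbS : b ∈ S := hTA (by simp)
    have hbhS : b + h ∈ S := hTA (by simp)
    have hbhh : b + h + h = b := by linear_combination hh
    rcases hu with hu | hu
    · exact hS.false_of_diametricalTriple haS hbS hbhS hd hah hab hab' hda hdb hdb' hu
    · refine hS.false_of_diametricalTriple (b := b + h) haS hbhS ?_ hd hah hab' ?_ hda hdb' ?_ ?_
      · rwa [hbhh]
      · rwa [hbhh]
      · rwa [hbhh]
      · rwa [← sub_sub]

/-! ### Minimal generating sets -/

/-- In a minimal generating set, each element `x` has a prime divisor of `n` that divides all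
other elements, but not `x`, so that distinct elements have distinct primes. -/
lemma exists_generating_triple_or_separating {n : ℕ} (hn : 0 < n) {S : Set (ZMod n)}
    (hcard : 3 ≤ S.ncard) (hgen : AddSubgroup.closure S = ⊤) (hn4 : n.primeFactors.card ≤ 4) :
    (∃ T ⊆ S, T.ncard = 3 ∧ AddSubgroup.closure T = ⊤) ∨
      (n.primeFactors.card = 4 ∧ ∃ x : ℕ → ZMod n, ∀ q ∈ n.primeFactors, x q ∈ S ∧
        ¬ (q : ZMod n) ∣ x q ∧ ∀ r ∈ n.primeFactors, r ≠ q → (q : ZMod n) ∣ x r) := by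
  have : NeZero n := ⟨hn.ne'⟩
  obtain ⟨M, ⟨hMS, hMgen⟩, hmin⟩ := exists_minimal_of_wellFoundedLT
    (fun M : Set (ZMod n) => M ⊆ S ∧ AddSubgroup.closure M = ⊤) ⟨S, subset_rfl, hgen⟩
  rcases le_or_gt M.ncard 3 with hM | hM
  · left
    obtain ⟨T, hMT, hTS, hT⟩ := Set.exists_subsuperset_card_eq hMS hM hcard
    exact ⟨T, hTS, hT, top_unique (hMgen ▸ AddSubgroup.closure_mono hMT)⟩
  · right
    have hp : ∀ x ∈ M, ∃ q ∈ n.primeFactors, ¬ (q : ZMod n) ∣ x ∧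
        ∀ y ∈ M, y ≠ x → (q : ZMod n) ∣ y := by
      intro x hx
      have hne : AddSubgroup.closure (M \ {x}) ≠ ⊤ := fun h =>
        (hmin ⟨Set.sdiff_subset.trans hMS, h⟩ Set.sdiff_subset hx).2 rfl
      obtain ⟨q, hq, hqn, hdvd⟩ := ZMod.exists_prime_dvd_of_closure_ne_top hne
      have hdvd' : ∀ y ∈ M, y ≠ x → (q : ZMod n) ∣ y := fun y hy hyx => hdvd y ⟨hy, hyx⟩
      refine ⟨q, Nat.mem_primeFactors.2 ⟨hq, hqn, hn.ne'⟩, fun hqx => ?_, hdvd'⟩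
      refine ZMod.closure_ne_top_of_dvd hqn hq.ne_one (fun y hy => ?_) hMgen
      rcases eq_or_ne y x with rfl | hyx
      exacts [hqx, hdvd' y hy hyx]
    choose! f hf hfx hfy using hp
    have hinj : Set.InjOn f M := fun x hx y hy hxy => by
      by_contra hne
      exact hfx x hx (hxy ▸ hfy y hy x hx hne)
    have hle : M.ncard ≤ n.primeFactors.card := by
      rw [← Set.ncard_coe_finset]
      exact Set.ncard_le_ncard_of_injOn f hf hinj
    have hsurj : ∀ q ∈ n.primeFactors, ∃ x ∈ M, f x = q := by
      have himg : f '' M = n.primeFactors :=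
        Set.eq_of_subset_of_ncard_le (Set.image_subset_iff.2 hf)
          (by rw [hinj.ncard_image, Set.ncard_coe_finset]; omega)
      intro q hq
      have hq' : q ∈ f '' M := himg ▸ Finset.mem_coe.2 hq
      exact hq'
    choose! x hxM hfxq using hsurj
    refine ⟨by omega, x, fun q hq => ⟨hMS (hxM q hq), ?_, fun r hr hrq => ?_⟩⟩
    · simpa only [hfxq q hq] using hfx (x q) (hxM q hq)
    · have hne : x r ≠ x q := fun e => hrq (by rw [← hfxq r hr, e, hfxq q hq])
      simpa only [hfxq q hq] using hfy (x q) (hxM q hq) (x r) (hxM r hr) hne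

/-! ### Hamiltonian circuits from words -/

/-- A word in the elements of `A`, all of whose proper prefix sums are distinct modulo `n`, and
whose sum vanishes modulo `n`, traces a hamiltonian circuit; so does the word that is multiplied
by a unit `u`. -/
lemma hasHamiltonianCircuit_of_word {n : ℕ} (hn : 0 < n) {A : Set ℤ} (L : List ℕ) (u : ZMod n)
    (hu : IsUnit u) (hlen : L.length = n)
    (hmem : ∀ a ∈ L, (a : ZMod n) * u ∈ ((↑) '' A : Set (ZMod n))) (hsum : n ∣ L.sum)
    (hnodup : ((List.range n).map fun i => (L.take i).sum % n).Nodup) :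
    (circulantDigraph n A).HasHamiltonianCircuit := by
  have : NeZero n := ⟨hn.ne'⟩
  refine ⟨n, hn, fun i => ((L.take i.val).sum : ZMod n) * u, ?_, fun i => ?_⟩
  · refine Finite.injective_iff_bijective.1 fun i j hij => ?_
    have hij' := (ZMod.natCast_eq_natCast_iff' _ _ _).1 (hu.mul_right_cancel hij)
    exact ZMod.val_injective n <| List.inj_on_of_nodup_map hnodup
      (List.mem_range.2 (ZMod.val_lt i)) (List.mem_range.2 (ZMod.val_lt j)) hij'
  · have hi : i.val < L.length := hlen ▸ ZMod.val_lt i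
    have hnext : (((L.take (i + 1).val).sum : ℕ) : ZMod n) = (L.take (i.val + 1)).sum := by
      rcases (Nat.succ_le_of_lt (ZMod.val_lt i)).lt_or_eq with hlt | heq
      · rw [ZMod.val_add, ZMod.val_one_eq_one_mod, Nat.add_mod_mod, Nat.mod_eq_of_lt hlt]
      · have h0 : i + 1 = 0 := by
          rw [← ZMod.natCast_zmod_val i, ← Nat.cast_one, ← Nat.cast_add, ← Nat.succ_eq_add_one,
            heq, ZMod.natCast_self]
        have hfull : L.take (i.val + 1) = L := List.take_of_length_le (by omega)
        rw [h0, hfull, (ZMod.natCast_eq_zero_iff _ _).2 hsum]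
        simp
    rw [circulantDigraph_adj_iff]
    beta_reduce
    rw [hnext, List.sum_take_succ _ _ hi]
    convert hmem _ (List.getElem_mem hi) using 1
    push_cast
    ring

/-- A word for a hamiltonian circuit of the product of directed cycles of lengths `2`, `3`, `5`
and odd `p ≥ 3`, with the letters `a`, `b`, `c`, `d` for the four directions. Each of the `p`
blocks traverses a hamiltonian path of one layer, the product of the first three cycles, and then
passes to the next layer by `d`. The paths arise from one hamiltonian circuit of the layer by
deleting an arc in direction `a` for `p - 3` of the blocks, and one in direction `b` for `3` of
them. They therefore move by `-a`, an even number of times, and by `-b`, three times, so that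
the walk closes up. -/
def productWord (p a b c d : ℕ) : List ℕ :=
  (List.replicate (p - 3)
    [b, b, c, b, b, c, b, b, c, b, b, c, b, b, a, c, b, c, b, b, c, b, b, c, b, b, c, b, c,
      d]).flatten ++
  (List.replicate 3
    [a, c, b, c, b, b, c, b, b, c, b, b, c, b, c, a, b, b, c, b, b, c, b, b, c, b, b, c, b,
      d]).flatten

lemma mem_of_mem_productWord {p a b c d x : ℕ} (hx : x ∈ productWord p a b c d) :
    x = a ∨ x = b ∨ x = c ∨ x = d := by
  simp only [productWord, List.mem_append, List.mem_flatten, List.mem_replicate] at hx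
  rcases hx with ⟨l, ⟨-, rfl⟩, hx⟩ | ⟨l, ⟨-, rfl⟩, hx⟩ <;>
  · simp only [List.mem_cons, List.not_mem_nil, or_false] at hx
    tauto

/-! ### Products of four directed cycles -/

/-- A family of residues of `ZMod n`, indexed by the prime divisors of `n`, in which each prime
divides all members but its own. For squarefree `n`, each member then generates one of the
factors of `ZMod n` of prime order. -/
def IsSeparating {n : ℕ} (x : ℕ → ZMod n) : Prop :=
  ∀ q ∈ n.primeFactors,
    ¬ (q : ZMod n) ∣ x q ∧ ∀ r ∈ n.primeFactors, r ≠ q → (q : ZMod n) ∣ x r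

lemma IsSeparating.isUnit_sum {n : ℕ} (hn : 0 < n) {x : ℕ → ZMod n} (hx : IsSeparating x) :
    IsUnit (∑ q ∈ n.primeFactors, x q) := by
  have hgen : AddSubgroup.closure {∑ q ∈ n.primeFactors, x q} = ⊤ := by
    by_contra hne
    obtain ⟨q, hq, hqn, hdvd⟩ := ZMod.exists_prime_dvd_of_closure_ne_top hne
    have hqQ : q ∈ n.primeFactors := Nat.mem_primeFactors.2 ⟨hq, hqn, hn.ne'⟩
    have hdvd := hdvd _ rfl
    rw [← Finset.add_sum_erase _ _ hqQ] at hdvd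
    refine (hx q hqQ).1 ((dvd_add_left (Finset.dvd_sum fun r hr => ?_)).1 hdvd)
    exact (hx q hqQ).2 r (Finset.mem_of_mem_erase hr) (Finset.ne_of_mem_erase hr)
  have h1 : (1 : ZMod n) ∈ AddSubgroup.closure {∑ q ∈ n.primeFactors, x q} :=
    hgen ▸ AddSubgroup.mem_top _
  obtain ⟨z, hz⟩ := AddSubgroup.mem_closure_singleton.1 h1
  rw [zsmul_eq_mul, mul_comm] at hz
  exact IsUnit.of_mul_eq_one _ hz

lemma IsSeparating.prime_mul_eq_zero {n : ℕ} (hn : ∏ q ∈ n.primeFactors, q = n) {x : ℕ → ZMod n}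
    (hx : IsSeparating x) {q : ℕ} (hq : q ∈ n.primeFactors) : (q : ZMod n) * x q = 0 := by
  have hdvd : ∏ r ∈ n.primeFactors.erase q, (r : ZMod n) ∣ x q := by
    refine Finset.prod_dvd_of_coprime (fun r hr s hs hrs => ?_) fun r hr => ?_
    · exact Nat.Coprime.cast ((Nat.coprime_primes
        (Nat.prime_of_mem_primeFactors (Finset.mem_of_mem_erase hr))
        (Nat.prime_of_mem_primeFactors (Finset.mem_of_mem_erase hs))).2 hrs)
    · exact (hx r (Finset.mem_of_mem_erase hr)).2 q hq (Finset.ne_of_mem_erase hr).symm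
  obtain ⟨t, ht⟩ := hdvd
  rw [ht, ← mul_assoc, Finset.mul_prod_erase _ (fun r : ℕ => (r : ZMod n)) hq, ← Nat.cast_prod,
    hn, ZMod.natCast_self, zero_mul]

/-- If `e` is `1` modulo the prime `q` and `0` modulo the other prime divisors of `n`, then it
projects the sum of a separating family to the member at `q`. -/
lemma IsSeparating.mul_sum_eq {n : ℕ} (hn : ∏ q ∈ n.primeFactors, q = n) {x : ℕ → ZMod n}
    (hx : IsSeparating x) {q e : ℕ} (hq : q ∈ n.primeFactors)
    (he : ∀ r ∈ n.primeFactors, e % r = if r = q then 1 else 0) :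
    (e : ZMod n) * ∑ r ∈ n.primeFactors, x r = x q := by
  rw [Finset.mul_sum, Finset.sum_eq_single_of_mem q hq]
  · have h := he q hq
    rw [if_pos rfl] at h
    rw [← Nat.mod_add_div e q, h]
    push_cast
    linear_combination ((e / q : ℕ) : ZMod n) * hx.prime_mul_eq_zero hn hq
  · intro r hr hrq
    have h := he r hr
    rw [if_neg hrq] at h
    rw [← Nat.mod_add_div e r, h]
    push_cast
    linear_combination ((e / r : ℕ) : ZMod n) * hx.prime_mul_eq_zero hn hr

/-- Up to the unit `x 2 + x 3 + x 5 + x p`, the members of the family are the idempotents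
`a, b, c, d`. -/
lemma IsSeparating.hasHamiltonianCircuit {n p a b c d : ℕ} (hn : 0 < n)
    (hprod : ∏ q ∈ n.primeFactors, q = n) (hQ : n.primeFactors = {2, 3, 5, p})
    {A : Set ℤ} {x : ℕ → ZMod n} (hx : IsSeparating x)
    (hxA : ∀ q ∈ n.primeFactors, x q ∈ ((↑) '' A : Set (ZMod n)))
    (ha : ∀ r ∈ n.primeFactors, a % r = if r = 2 then 1 else 0)
    (hb : ∀ r ∈ n.primeFactors, b % r = if r = 3 then 1 else 0)
    (hc : ∀ r ∈ n.primeFactors, c % r = if r = 5 then 1 else 0)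
    (hd : ∀ r ∈ n.primeFactors, d % r = if r = p then 1 else 0)
    (hlen : (productWord p a b c d).length = n)
    (hsum : n ∣ (productWord p a b c d).sum)
    (hnodup : ((List.range n).map fun i => ((productWord p a b c d).take i).sum % n).Nodup) :
    (circulantDigraph n A).HasHamiltonianCircuit := by
  refine hasHamiltonianCircuit_of_word hn _ _ (hx.isUnit_sum hn) hlen (fun y hy => ?_) hsum hnodup
  have h2 : 2 ∈ n.primeFactors := by simp [hQ]
  have h3 : 3 ∈ n.primeFactors := by simp [hQ]
  have h5 : 5 ∈ n.primeFactors := by simp [hQ]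
  have hp : p ∈ n.primeFactors := by simp [hQ]
  rcases mem_of_mem_productWord hy with rfl | rfl | rfl | rfl
  · exact hx.mul_sum_eq hprod h2 ha ▸ hxA 2 h2
  · exact hx.mul_sum_eq hprod h3 hb ▸ hxA 3 h3
  · exact hx.mul_sum_eq hprod h5 hc ▸ hxA 5 h5
  · exact hx.mul_sum_eq hprod hp hd ▸ hxA p hp

/-! ### Orders below 420 -/

/-- The least integer with five prime divisors is `2310`. -/
lemma card_primeFactors_le_four_of_lt : ∀ n < 420, n.primeFactors.card ≤ 4 := by
  decide +kernel

/-- The bound `420` enters here: the next integer with four prime divisors is `420`, which is not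
squarefree. -/
lemma eq_of_card_primeFactors_eq_four :
    ∀ n < 420, n.primeFactors.card = 4 → n = 210 ∨ n = 330 ∨ n = 390 := by
  decide +kernel

theorem corollary5p2 (n : ℕ) (hn : 0 < n) (hn420 : n < 420) (A : Set ℤ)
    (hloop : (circulantDigraph n A).IsLoopless)
    (hconn : (circulantDigraph n A).IsConnected)
    (hdeg : ∀ v, 4 ≤ (circulantDigraph n A).outdegree v)
    (hdescribed : ∀ B : Set ℤ,
      (circulantDigraph n B).IsLoopless →
      (circulantDigraph n B).IsConnected →
      (∀ v, (circulantDigraph n B).outdegree v = 3) →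
      ¬ (circulantDigraph n B).HasHamiltonianCircuit →
      IsOrderTwoType n B ∨ IsDiametricalType n B) :
    (circulantDigraph n A).HasHamiltonianCircuit := by
  have hcard := circulantDigraph_outdegree (0 : ZMod n) ▸ hdeg 0
  rcases exists_generating_triple_or_separating hn (by omega)
    (circulantDigraph_isConnected_iff.1 hconn) (card_primeFactors_le_four_of_lt n hn420) with
    ⟨T, hTA, hT, hgen⟩ | ⟨h4, x, hx⟩
  · exact hasHamiltonianCircuit_of_generating_triple hn hloop hdescribed hcard hTA hT hgen
  · have hxA := fun q hq => (hx q hq).1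
    have hsep : IsSeparating x := fun q hq => (hx q hq).2
    rcases eq_of_card_primeFactors_eq_four n hn420 h4 with rfl | rfl | rfl
    · apply hsep.hasHamiltonianCircuit (p := 7) (a := 105) (b := 70) (c := 126) (d := 120)
        hn ?_ ?_ hxA <;> decide +kernel
    · apply hsep.hasHamiltonianCircuit (p := 11) (a := 165) (b := 220) (c := 66) (d := 210)
        hn ?_ ?_ hxA <;> decide +kernel
    · apply hsep.hasHamiltonianCircuit (p := 13) (a := 195) (b := 130) (c := 156) (d := 300)
        hn ?_ ?_ hxA <;> decide +kernel
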